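/- Let $(W,S)$ be a Coxeter system with $n(s,t)<\infty$ for all $s,t\in S$, where $n(s,t)$ denotes the order of $st$ in $W$, let $u$ be an indeterminate, and let $H$ be its Hecke algebra over $\mathbb{Q}(u)$, that is, the algebra with generators $T_s$ ($s\in S$) and relations $(T_s-u^2)(T_s+1)=0$ for $s \in S$ and $T_sT_tT_s\cdots=T_tT_sT_t\cdots$ ($n(s,t)$ factors on either side) for $s\ne t$ in $S$. An $S$-labeled digraph $\Gamma$ is a directed multigraph without loops, each of whose edges is either solid or dashed and is labeled by an element of $S$, such that for every $s\in S$ every vertex occurs in exactly one edge labeled $s$. Let $M(\Gamma)$ be the $\mathbb{Q}(u)$-vector space with basis the set $V(\Gamma)$ of vertices, and for $s\in S$ let $\tau_s$ be the linear operator on $M(\Gamma)$ such that, for each edge labeled $s$ from a vertex $\alpha$ to a vertex $\beta$, $$\tau_s(\alpha)=\beta,\qquad \tau_s(\beta)=(u^2-1)\beta+u^2\alpha$$ if the edge is solid, and $$\tau_s(\alpha)=u\alpha+(u+1)\beta,\qquad \tau_s(\beta)=(u^2-u-1)\beta+(u^2-u)\alpha$$ if the edge is dashed. $\Gamma$ is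 called a $W$-digraph if $T_s\mapsto\tau_s$ extends to a homomorphism of $\mathbb{Q}(u)$-algebras from $H$ to the algebra of all linear operators on $M(\Gamma)$. It is called connected if its underlying undirected multigraph is connected; a source (sink) is a vertex towards which (away from which) no edge is directed. **Theorem.** Let $\Gamma$ be a connected $W$-digraph that has a source or a sink. Then for all $\alpha,\beta\in V(\Gamma)$, any two directed paths from $\alpha$ to $\beta$ in $\Gamma$ have the same number of edges. (Paths may be empty, and may repeat vertices and edges.) -/

import Mathlib

noncomputable section

namespace WDigraph

/-- The field `ℚ(u)` of rational functions in one indeterminate. -/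
abbrev K : Type := RatFunc ℚ

/-- The indeterminate `u` of `ℚ(u)`. -/
def u : K := RatFunc.X

/-- The alternating product `a * b * a * ⋯` with `n` factors, the first one being `a`. -/
def altProd {R : Type*} [Monoid R] (a b : R) : ℕ → R
  | 0 => 1
  | n + 1 => a * altProd b a n

/-- The defining relations of the Hecke algebra of a Coxeter matrix `M`: the quadratic relations
`(T_s - u²)(T_s + 1) = 0`, and the braid relations `T_s T_t ⋯ = T_t T_s ⋯` (`n(s,t)` factors on
either side) for `1 < n(s,t) < ∞`. Mathlib encodes `n(s,t) = ∞` as `M s t = 0`, so that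
`1 < M s t` means `1 < n(s,t) < ∞`. -/
inductive HeckeRel {S : Type*} (M : CoxeterMatrix S) :
    FreeAlgebra K S → FreeAlgebra K S → Prop
  | quadratic (s : S) :
      HeckeRel M
        ((FreeAlgebra.ι K s - algebraMap K (FreeAlgebra K S) (u ^ 2)) * (FreeAlgebra.ι K s + 1)) 0
  | braid (s t : S) (h : 1 < M s t) :
      HeckeRel M
        (altProd (FreeAlgebra.ι K s) (FreeAlgebra.ι K t) (M s t))
        (altProd (FreeAlgebra.ι K t) (FreeAlgebra.ι K s) (M s t))

/-- The (one-parameter, parameter `u²`) Hecke algebra over `ℚ(u)` of the Coxeter system with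
Coxeter matrix `M`. -/
abbrev HeckeAlgebra {S : Type*} (M : CoxeterMatrix S) : Type _ := RingQuot (HeckeRel M)

/-- The generator `T_s` of the Hecke algebra. -/
def HeckeAlgebra.T {S : Type*} (M : CoxeterMatrix S) (s : S) : HeckeAlgebra M :=
  RingQuot.mkAlgHom K (HeckeRel M) (FreeAlgebra.ι K s)

/-- The two types of edges. -/
inductive EdgeKind
  | solid
  | dashed

/-- A possible edge on the vertex set `V`: a directed edge from `src` to `tgt`, labeled by an
element of `S`, and either solid or dashed. -/
structure LabeledEdge (S V : Type*) where
  kind : EdgeKind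
  src : V
  tgt : V
  label : S

/-- An `S`-labeled digraph with vertex set `V`: a directed multigraph with solid or dashed edges
labeled by elements of `S`, without loops, such that for all `s ∈ S` every vertex occurs in
exactly one edge labeled `s`. (Because of the last condition there cannot be two edges with the
same ends, direction, label and type, so a set of edges suffices.) -/
structure LabeledDigraph (S V : Type*) where
  edges : Set (LabeledEdge S V)
  no_loops : ∀ e ∈ edges, e.src ≠ e.tgt
  existsUnique_edge : ∀ (s : S) (α : V),
    ∃! e : LabeledEdge S V, e ∈ edges ∧ e.label = s ∧ (e.src = α ∨ e.tgt = α)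

namespace LabeledDigraph

variable {S V : Type*} (Γ : LabeledDigraph S V)

/-- The unique edge labeled `s` in which the vertex `α` occurs. -/
def edgeAt (s : S) (α : V) : LabeledEdge S V := (Γ.existsUnique_edge s α).choose

open Classical in
/-- The vector `τ_s(α)` of the vector space `M(Γ) = V →₀ ℚ(u)` with basis `V`. The vertex `α` is
either the initial or the final vertex of the edge labeled `s` at `α`, and not both. -/
def tauVertex (s : S) (α : V) : V →₀ K :=
  let e := Γ.edgeAt s α
  match e.kind with
  | .solid =>
      if e.src = α then Finsupp.single e.tgt 1
      else Finsupp.single α (u ^ 2 - 1) + Finsupp.single e.src (u ^ 2)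
  | .dashed =>
      if e.src = α then Finsupp.single α u + Finsupp.single e.tgt (u + 1)
      else Finsupp.single α (u ^ 2 - u - 1) + Finsupp.single e.src (u ^ 2 - u)

/-- The linear operator `τ_s` on `M(Γ) = V →₀ ℚ(u)`. -/
def tau (s : S) : Module.End K (V →₀ K) :=
  Finsupp.linearCombination K (Γ.tauVertex s)

/-- `Γ` is a `W`-digraph, where `(W, S)` is the Coxeter system with Coxeter matrix `M`: the
mapping `T_s ↦ τ_s` extends to a homomorphism of `ℚ(u)`-algebras from the Hecke algebra to the
algebra of all linear operators on `M(Γ)`. -/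
def IsWDigraph (M : CoxeterMatrix S) : Prop :=
  ∃ ρ : HeckeAlgebra M →ₐ[K] Module.End K (V →₀ K),
    ∀ s : S, ρ (HeckeAlgebra.T M s) = Γ.tau s

/-- There is an edge (of any label and type) directed from `α` to `β`. -/
def Arrow (α β : V) : Prop := ∃ e ∈ Γ.edges, e.src = α ∧ e.tgt = β

/-- `α` is a source: no edge is directed towards `α`. -/
def IsSource (α : V) : Prop := ∀ β : V, ¬ Γ.Arrow β α

/-- `α` is a sink: no edge is directed away from `α`. -/
def IsSink (α : V) : Prop := ∀ β : V, ¬ Γ.Arrow α β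

/-- `Γ` is connected: the underlying undirected graph is connected. (Multiple edges do not matter
for this, and there are no loops.) -/
def IsConnected : Prop := (SimpleGraph.fromRel Γ.Arrow).Connected

/-- The underlying directed multigraph, labels and types of edges being forgotten: the arrows from
`α` to `β` are the edges directed from `α` to `β`. -/
abbrev dir : Quiver V where
  Hom α β := {e : LabeledEdge S V // e ∈ Γ.edges ∧ e.src = α ∧ e.tgt = β}

/-- Directed paths from `α` to `β` in `Γ`: finite, possibly empty sequences of consecutive edges,
in which vertices and edges may be repeated. -/
abbrev DirectedPath (α β : V) : Type _ := @Quiver.Path V Γ.dir α β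

/-- The number of edges of a directed path. -/
abbrev numEdges {α β : V} (π : Γ.DirectedPath α β) : ℕ := @Quiver.Path.length V Γ.dir α β π

end LabeledDigraph

end WDigraph

end

namespace WDigraph

/-! It suffices to find a height function that rises by 1 along every arrow. With a source σ, the
height is the length of a directed walk from σ. A descent (`walk_pred`) reduces its well-definedness
to pairs of labels s ≠ t: if x has no incoming {s,t}-edges and y is m + 1 such steps from x, then
each {s,t}-predecessor of y is m steps from x.

For this claim (`walk_of_step_of_dominant`), the antisymmetrizer of the dihedral Hecke algebra turns
x into a vector w with τ_s w = τ_t w = -w. Along an edge, the coordinates of such a vector have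
ratio -u² or -u(u-1)/(u+1). Both vanish to total order 2 at u = 0 and u = 1, so this order counts
steps on the support of w. As the support is finite, walking backwards ends at a local source. At u
= ∞ the coordinate of w at x dominates all others; comparison with the vector built from the other
source shows that this source is x. For a sink, the arrows are reversed and dominance is measured at
u = 0. -/

/-- `Walk B x m y`: there is a chain of `m` successive `B`-steps from `x` to `y`. -/
inductive Walk {V : Type*} (B : V → V → Prop) (x : V) : ℕ → V → Prop
  | nil : Walk B x 0 x
  | snoc {m : ℕ} {y z : V} : Walk B x m y → B y z → Walk B x (m + 1) z

namespace Walk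

variable {V : Type*} {B C : V → V → Prop} {x y z : V} {m n : ℕ}

theorem mono (h : ∀ a b, B a b → C a b) (w : Walk B x m y) : Walk C x m y := by
  induction w with
  | nil => exact nil
  | snoc _ hb ih => exact ih.snoc (h _ _ hb)

theorem trans (w : Walk B x m y) (w' : Walk B y n z) : Walk B x (m + n) z := by
  induction w' with
  | nil => exact w
  | snoc _ hb ih => exact ih.snoc hb

end Walk

/-! ### Reduction of the grading to rank two. -/

section Grading

variable {S V : Type*} {A : S → V → V → Prop} {σ : V}

/-- Going backwards along `{s, t}`-steps from a vertex reached from `σ`, one ends at a vertex without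
incoming `{s, t}`-steps. -/
theorem exists_local_source (s t : S) (m : ℕ)
    (hpred : ∀ k ≤ m, ∀ y z : V, Walk (fun a b => ∃ r, A r a b) σ k y → (∃ r, A r z y) →
      ∃ j, k = j + 1 ∧ Walk (fun a b => ∃ r, A r a b) σ j z)
    (y : V) (hy : Walk (fun a b => ∃ r, A r a b) σ m y) :
    ∃ x k j, k + j = m ∧ Walk (fun a b => ∃ r, A r a b) σ k x ∧
      Walk (fun a b => A s a b ∨ A t a b) x j y ∧ ∀ z, ¬ (A s z x ∨ A t z x) := by
  induction m generalizing y with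
  | zero =>
    refine ⟨y, 0, 0, rfl, hy, .nil, fun z hz => ?_⟩
    obtain ⟨j, hj, -⟩ := hpred 0 le_rfl y z hy (hz.elim (fun h => ⟨s, h⟩) fun h => ⟨t, h⟩)
    omega
  | succ m ih =>
    by_cases hs : ∀ z, ¬ (A s z y ∨ A t z y)
    · exact ⟨y, m + 1, 0, rfl, hy, .nil, hs⟩
    · push Not at hs
      obtain ⟨z, hz⟩ := hs
      obtain ⟨j, hj, hw⟩ :=
        hpred _ le_rfl y z hy (hz.elim (fun h => ⟨s, h⟩) fun h => ⟨t, h⟩)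
      obtain rfl : m = j := by omega
      obtain ⟨x, k, j, hkj, hx, hxz, hsrc⟩ := ih (fun k hk => hpred k (by omega)) z hw
      exact ⟨x, k, j + 1, by omega, hx, hxz.snoc hz, hsrc⟩

/-- Strong induction on the length. If the last step y' → y and the arrow z → y have different
labels, descend from y' to a local source x, j steps before y'. Then `hloc` replaces the j + 1 steps
from x to y by j steps from x to z. -/
theorem walk_pred
    (hinj : ∀ s x y z, A s x z → A s y z → x = y)
    (hloc : ∀ s t, s ≠ t → ∀ x, (∀ z, ¬ (A s z x ∨ A t z x)) → ∀ m y z,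
      Walk (fun a b => A s a b ∨ A t a b) x (m + 1) y → (A s z y ∨ A t z y) →
        Walk (fun a b => A s a b ∨ A t a b) x m z)
    (hσ : ∀ s x, ¬ A s x σ) (m : ℕ) (y z : V)
    (hy : Walk (fun a b => ∃ r, A r a b) σ m y) (hz : ∃ r, A r z y) :
    ∃ j, m = j + 1 ∧ Walk (fun a b => ∃ r, A r a b) σ j z := by
  induction m using Nat.strong_induction_on generalizing y z with
  | _ m ih =>
    cases hy with
    | nil => exact absurd hz.choose_spec (hσ _ _)
    | @snoc m y' _ hy' hstep =>
      obtain ⟨t, ht⟩ := hstep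
      obtain ⟨s, hs⟩ := hz
      refine ⟨m, rfl, ?_⟩
      by_cases hst : s = t
      · subst hst
        rwa [hinj s z y' y hs ht]
      · obtain ⟨x, k, j, rfl, hx, hxy, hsrc⟩ := exists_local_source s t m
          (fun k hk y z => ih k (by omega) y z) y' hy'
        refine hx.trans ((hloc s t hst x hsrc j y z (hxy.snoc (.inr ht)) (.inl hs)).mono ?_)
        rintro a b (h | h)
        exacts [⟨s, h⟩, ⟨t, h⟩]

/-- If backward steps in rank two can be completed from local sources, a connected labeled relation
with a global source is graded. -/
theorem exists_grading
    (hinj : ∀ s x y z, A s x z → A s y z → x = y)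
    (hloc : ∀ s t, s ≠ t → ∀ x, (∀ z, ¬ (A s z x ∨ A t z x)) → ∀ m y z,
      Walk (fun a b => A s a b ∨ A t a b) x (m + 1) y → (A s z y ∨ A t z y) →
        Walk (fun a b => A s a b ∨ A t a b) x m z)
    (hσ : ∀ s x, ¬ A s x σ)
    (hconn : ∀ x, Relation.ReflTransGen (fun a b => (∃ s, A s a b) ∨ ∃ s, A s b a) σ x) :
    ∃ h : V → ℤ, ∀ s x y, A s x y → h y = h x + 1 := by
  have hpred := walk_pred hinj hloc hσ
  have hreach : ∀ x, ∃ m, Walk (fun a b => ∃ r, A r a b) σ m x := fun x => by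
    induction hconn x with
    | refl => exact ⟨0, .nil⟩
    | tail _ hbc ih =>
      obtain ⟨m, hm⟩ := ih
      rcases hbc with h | h
      · exact ⟨m + 1, hm.snoc h⟩
      · obtain ⟨j, -, hj⟩ := hpred m _ _ hm h
        exact ⟨j, hj⟩
  -- The last step of the first walk is pulled back along the second; no nonempty walk returns to σ.
  have huniq : ∀ m n x, Walk (fun a b => ∃ r, A r a b) σ m x →
      Walk (fun a b => ∃ r, A r a b) σ n x → m = n := by
    intro m
    induction m with
    | zero =>
      intro n x hm hn
      cases hm
      cases hn with
      | nil => rfl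
      | snoc _ h => exact absurd h.choose_spec (hσ _ _)
    | succ m ih =>
      intro n x hm hn
      cases hm with
      | snoc hw hstep =>
        obtain ⟨j, rfl, hj⟩ := hpred n _ _ hn hstep
        rw [ih j _ hw hj]
  choose f hf using hreach
  refine ⟨fun x => f x, fun s x y h => ?_⟩
  have := huniq _ _ y (hf y) ((hf x).snoc ⟨s, h⟩)
  simp only [this]
  push_cast
  rfl

end Grading

/-! ### Rank two: uniqueness of the local source and step counting. -/

/-- The rank two argument. `W` is a set of finitely supported functions satisfying
the same proportionality relation along every step, whose ratio has negative degree `d` for `gr`; for every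
source `x` there is such a function with value of norm `1` at `x`, and of norm `< 1` elsewhere. -/
theorem walk_of_step_of_dominant {V F G : Type*} [Field F] [LinearOrderedCommGroupWithZero G]
    (v : Valuation F G) (gr : F → ℤ)
    (hgr : ∀ a b, a ≠ 0 → b ≠ 0 → gr (a * b) = gr a + gr b)
    (B : V → V → Prop) (W : Set (V →₀ F)) (d : ℤ) (hd : d < 0)
    (hB : ∀ x y, B x y → ∃ ρ : F, ρ ≠ 0 ∧ gr ρ = d ∧ ∀ w ∈ W, w x = ρ * w y)
    (hW : ∀ x, (∀ z, ¬ B z x) → ∃ w ∈ W, v (w x) = 1 ∧ ∀ y, y ≠ x → v (w y) < 1)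
    (x : V) (hx : ∀ z, ¬ B z x) (m : ℕ) (y z : V) (hy : Walk B x (m + 1) y) (hz : B z y) :
    Walk B x m z := by
  obtain ⟨w, hwW, hwx, hw⟩ := hW x hx
  -- At `a`, each `w'` is in the same proportion to `w` as at `x`. The ratio along a step is the
  -- same for all vectors in `W`, so `P` passes along steps both ways.
  let P : V → Prop := fun a => w a ≠ 0 ∧ ∀ w' ∈ W, w x * w' a = w' x * w a
  have hwx0 : w x ≠ 0 := fun h => by simp [h] at hwx
  have hPx : P x := ⟨hwx0, fun w' _ => mul_comm _ _⟩
  have hP : ∀ a b, B a b → (P a ↔ P b) := by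
    intro a b hab
    obtain ⟨ρ, hρ, -, h⟩ := hB a b hab
    simp only [P, h w hwW]
    refine and_congr (by simp [hρ]) (forall₂_congr fun w' hw' => ?_)
    rw [h w' hw', mul_left_comm, mul_left_comm (w' x), mul_right_inj' hρ]
  have hdeg : ∀ a b, B a b → w b ≠ 0 → gr (w a) = gr (w b) + d := by
    intro a b hab hb
    obtain ⟨ρ, hρ, hρd, h⟩ := hB a b hab
    rw [h w hwW, hgr _ _ hρ hb, hρd, add_comm]
  -- A backward step lowers `gr` and stays in the finite support, so the number of support points of
  -- lower degree decreases.
  have hdesc : ∀ k b, (w.support.filter fun a => gr (w a) < gr (w b)).card = k → P b →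
      ∃ a j, Walk B a j b ∧ P a ∧ ∀ z, ¬ B z a := by
    intro k
    induction k using Nat.strong_induction_on with
    | _ k ih =>
      intro b hk hb
      by_cases hs : ∀ z, ¬ B z b
      · exact ⟨b, 0, .nil, hb, hs⟩
      · push Not at hs
        obtain ⟨c, hc⟩ := hs
        have hPc := (hP c b hc).2 hb
        have hlt : gr (w c) < gr (w b) := by rw [hdeg c b hc hb.1]; omega
        obtain ⟨a, j, haj, hPa, hsrc⟩ := ih _ (by
          rw [← hk]
          refine Finset.card_lt_card ⟨fun e he => ?_, fun hsub => ?_⟩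
          · simp only [Finset.mem_filter] at he ⊢
            exact ⟨he.1, he.2.trans hlt⟩
          · have := hsub (Finset.mem_filter.2 ⟨Finsupp.mem_support_iff.2 hPc.1, hlt⟩)
            simp at this) c rfl hPc
        exact ⟨a, j + 1, haj.snoc hc, hPa, hsrc⟩
  have hwalk : ∀ a j b, Walk B a j b → P a → P b ∧ gr (w a) = gr (w b) + j * d := by
    intro a j b hab ha
    induction hab with
    | nil => exact ⟨ha, by simp⟩
    | snoc _ hstep ih =>
      have hb := (hP _ _ hstep).1 ih.1
      refine ⟨hb, ?_⟩
      rw [ih.2, hdeg _ _ hstep hb.1]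
      push_cast
      ring
  obtain ⟨hPy, hdy⟩ := hwalk _ _ _ hy hPx
  have hPz := (hP z y hz).2 hPy
  have hdz := hdeg z y hz hPy.1
  obtain ⟨a, j, haz, hPa, ha⟩ := hdesc _ z rfl hPz
  -- Otherwise `w x * w' a` has norm 1, while `w' x * w a` has norm less than 1.
  have hax : a = x := by
    by_contra hne
    obtain ⟨w', hw'W, hwa', hw'⟩ := hW a ha
    have h := congrArg v (hPa.2 w' hw'W)
    rw [map_mul, map_mul, hwx, hwa', one_mul] at h
    exact absurd h (mul_lt_one_of_lt_of_le (hw' x (Ne.symm hne)) (hw a hne).le).ne'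
  subst hax
  obtain ⟨-, hdj⟩ := hwalk _ _ _ haz hPx
  -- The degree of `w z` is computed through `y` and along the walk of `j` steps; `d ≠ 0` gives
  -- equality.
  have : (m : ℤ) = j := by
    have h : ((m : ℤ) - j) * d = 0 := by
      push_cast at hdy
      linear_combination hdj - hdy + hdz
    rcases mul_eq_zero.1 h with h | h <;> omega
  rwa [show m = j by exact_mod_cast this]

end WDigraph

noncomputable section

namespace WDigraph

/-! ### The dihedral antisymmetrizer. -/

section Antisymmetrizer

variable {F R : Type*} [Field F] [Ring R] [Algebra F R]

/-- The dihedral antisymmetrizer `∑ (-1)^ℓ(w) q^{-ℓ(w)} T_w`, where `c = -q⁻¹`. -/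
def antisymmetrizer (c : F) (a b : R) (n : ℕ) : R :=
  ∑ j ∈ Finset.range n, (c ^ j • altProd b a j + c ^ (j + 1) • altProd a b (j + 1))

/-- The sum has the words of length 0 to n - 1 beginning with b and those of length 1 to n beginning
with a. Exchanging the letters affects only which longest word occurs, and the two longest words
agree. -/
theorem antisymmetrizer_comm (c : F) {a b : R} {n : ℕ} (h : altProd a b n = altProd b a n) :
    antisymmetrizer c a b n = antisymmetrizer c b a n := by
  have key : ∀ x y : R, ∑ j ∈ Finset.range n, c ^ (j + 1) • altProd x y (j + 1) + 1 =
      ∑ j ∈ Finset.range n, c ^ j • altProd x y j + c ^ n • altProd x y n := fun x y => by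
    rw [← Finset.sum_range_succ, Finset.sum_range_succ']
    simp [altProd]
  have h1 := key a b
  have h2 := key b a
  rw [← h] at h2
  simp only [antisymmetrizer, Finset.sum_add_distrib]
  rw [← sub_eq_zero] at h1 h2 ⊢
  rw [← sub_eq_zero.2 (h1.trans h2.symm)]
  abel

/-- The words pair off as y, ay, and the quadratic relation gives a(y - q⁻¹ay) = -(y - q⁻¹ay). -/
theorem mul_antisymmetrizer (q : F) (hq : q ≠ 0) {a : R} (b : R) (n : ℕ)
    (h : a * a = (q - 1) • a + q • (1 : R)) :
    a * antisymmetrizer (-q⁻¹) a b n = -antisymmetrizer (-q⁻¹) a b n := by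
  rw [antisymmetrizer, Finset.mul_sum, ← Finset.sum_neg_distrib]
  refine Finset.sum_congr rfl fun j _ => ?_
  have h1 : a * altProd a b (j + 1) = (q - 1) • altProd a b (j + 1) + q • altProd b a j := by
    simp only [altProd]
    rw [← mul_assoc, h, add_mul, smul_mul_assoc, smul_mul_assoc, one_mul]
  have h2 : a * altProd b a j = altProd a b (j + 1) := rfl
  rw [mul_add, mul_smul_comm, mul_smul_comm, h1, h2, pow_succ]
  match_scalars
  all_goals field_simp
  ring

end Antisymmetrizer

/-! ### Dominant coordinates modulo small vectors. -/

/-- The finitely supported functions all of whose values have norm `< 1`. -/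
def smallSubgroup {F G : Type*} [Field F] [LinearOrderedCommGroupWithZero G]
    (v : Valuation F G) (V : Type*) : AddSubgroup (V →₀ F) where
  carrier := {w | ∀ x, v (w x) < 1}
  zero_mem' x := by simp
  add_mem' ha hb x := v.map_add_lt (ha x) (hb x)
  neg_mem' ha x := by simpa using ha x

section Dominant

variable {F G V : Type*} [Field F] [LinearOrderedCommGroupWithZero G] {v : Valuation F G}

theorem smul_mem_smallSubgroup {c : F} (hc : v c ≤ 1) {w : V →₀ F} (hw : w ∈ smallSubgroup v V) :
    c • w ∈ smallSubgroup v V := fun x => by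
  simpa [mul_comm] using mul_lt_one_of_lt_of_le (hw x) hc

theorem dominant_of_sub_mem {w : V →₀ F} {x : V} {k : F} (hk : v k = 1)
    (h : w - Finsupp.single x k ∈ smallSubgroup v V) :
    v (w x) = 1 ∧ ∀ y, y ≠ x → v (w y) < 1 := by
  constructor
  · have := h x
    rw [Finsupp.sub_apply, Finsupp.single_eq_same] at this
    have h2 := v.map_add_eq_of_lt_left (hk.symm ▸ this)
    rw [add_sub_cancel] at h2
    rw [h2, hk]
  · intro y hy
    simpa [Finsupp.single_eq_of_ne hy] using h y

/-- `c a` and `c b` preserve the small vectors and make `x` small. -/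
theorem altProd_smul_mem {c : F} {a b : Module.End F (V →₀ F)} {x : V →₀ F}
    (ha : ∀ w ∈ smallSubgroup v V, c • a w ∈ smallSubgroup v V)
    (hb : ∀ w ∈ smallSubgroup v V, c • b w ∈ smallSubgroup v V)
    (hax : c • a x ∈ smallSubgroup v V) (hbx : c • b x ∈ smallSubgroup v V) (j : ℕ) :
    (c ^ (j + 1) • altProd a b (j + 1)) x ∈ smallSubgroup v V := by
  induction j generalizing a b with
  | zero => simpa [altProd] using hax
  | succ j ih =>
    have h := ha _ (ih hb ha hbx hax)
    have e : (c ^ (j + 1 + 1) • altProd a b (j + 1 + 1)) x =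
        c • a ((c ^ (j + 1) • altProd b a (j + 1)) x) := by
      simp only [altProd, LinearMap.smul_apply, map_smul, smul_smul, Module.End.mul_apply]
      rw [← pow_succ']
    rwa [e]

/-- Only the empty word contributes a vector that is not small: each letter carries a factor c, and
the innermost one already makes x small. -/
theorem antisymmetrizer_source {c : F} {a b : Module.End F (V →₀ F)} {x : V →₀ F}
    (ha : ∀ w ∈ smallSubgroup v V, c • a w ∈ smallSubgroup v V)
    (hb : ∀ w ∈ smallSubgroup v V, c • b w ∈ smallSubgroup v V)
    (hax : c • a x ∈ smallSubgroup v V) (hbx : c • b x ∈ smallSubgroup v V)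
    {n : ℕ} (hn : n ≠ 0) : antisymmetrizer c a b n x - x ∈ smallSubgroup v V := by
  obtain ⟨n, rfl⟩ := Nat.exists_eq_succ_of_ne_zero hn
  rw [antisymmetrizer, Finset.sum_add_distrib, Finset.sum_range_succ', LinearMap.add_apply,
    LinearMap.add_apply, LinearMap.sum_apply, LinearMap.sum_apply]
  have h0 : (c ^ 0 • altProd b a 0) x = x := by simp [altProd]
  rw [h0, add_right_comm, add_sub_cancel_right]
  exact add_mem (sum_mem fun j _ => altProd_smul_mem hb ha hbx hax j)
    (sum_mem fun j _ => altProd_smul_mem ha hb hax hbx j)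

/-- `a` and `b` preserve the small vectors, and `a x` and `b x` are `-x` up to small vectors. -/
theorem altProd_sub_mem {a b : Module.End F (V →₀ F)} {x : V →₀ F}
    (ha : ∀ w ∈ smallSubgroup v V, a w ∈ smallSubgroup v V)
    (hb : ∀ w ∈ smallSubgroup v V, b w ∈ smallSubgroup v V)
    (hax : a x + x ∈ smallSubgroup v V) (hbx : b x + x ∈ smallSubgroup v V) (j : ℕ) :
    altProd a b j x - (-1 : F) ^ j • x ∈ smallSubgroup v V := by
  induction j generalizing a b with
  | zero => simp [altProd, (smallSubgroup v V).zero_mem]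
  | succ j ih =>
    have h := add_mem (ha _ (ih hb ha hbx hax))
      (smul_mem_smallSubgroup (c := (-1) ^ j) (by simp) hax)
    convert h using 1
    simp only [altProd, Module.End.mul_apply, map_sub, map_smul, pow_succ]
    module

/-- Modulo small vectors a word of length j multiplies x by (-1)^j. After scaling its coefficient is
c^(j-n), which is small unless j = n, so only the longest word survives. -/
theorem antisymmetrizer_sink {c : F} (hc0 : c ≠ 0) (hc : v c⁻¹ < 1)
    {a b : Module.End F (V →₀ F)} {x : V}
    (ha : ∀ w ∈ smallSubgroup v V, a w ∈ smallSubgroup v V)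
    (hb : ∀ w ∈ smallSubgroup v V, b w ∈ smallSubgroup v V)
    (hax : a (Finsupp.single x 1) + Finsupp.single x 1 ∈ smallSubgroup v V)
    (hbx : b (Finsupp.single x 1) + Finsupp.single x 1 ∈ smallSubgroup v V)
    {n : ℕ} (hn : n ≠ 0) :
    (c⁻¹ ^ n • antisymmetrizer c a b n) (Finsupp.single x 1) - Finsupp.single x ((-1) ^ n) ∈
      smallSubgroup v V := by
  have hx1 : ∀ y, v ((Finsupp.single x (1 : F)) y) ≤ 1 := fun y => by
    classical
    rw [Finsupp.single_apply]
    split_ifs <;> simp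
  have hsmall : ∀ k : F, v k < 1 → k • Finsupp.single x (1 : F) ∈ smallSubgroup v V :=
    fun k hk y => by
      rw [Finsupp.smul_apply, smul_eq_mul, map_mul]
      exact mul_lt_one_of_lt_of_le hk (hx1 y)
  have hterm : ∀ {a b : Module.End F (V →₀ F)},
      (∀ w ∈ smallSubgroup v V, a w ∈ smallSubgroup v V) →
      (∀ w ∈ smallSubgroup v V, b w ∈ smallSubgroup v V) →
      (a (Finsupp.single x 1) + Finsupp.single x 1 ∈ smallSubgroup v V) →
      (b (Finsupp.single x 1) + Finsupp.single x 1 ∈ smallSubgroup v V) → ∀ j < n,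
      (c⁻¹ ^ n • c ^ j • altProd a b j) (Finsupp.single x 1) ∈ smallSubgroup v V := by
    intro a b ha hb hax hbx j hj
    have h1 : c⁻¹ ^ n * c ^ j = c⁻¹ ^ (n - j) := by
      rw [show n = (n - j) + j by omega, pow_add, mul_assoc, ← mul_pow, inv_mul_cancel₀ hc0]
      simp
    have h2 : v (c⁻¹ ^ (n - j)) < 1 := by
      rw [map_pow]
      exact pow_lt_one₀ zero_le hc (by omega)
    rw [smul_smul, h1, LinearMap.smul_apply,
      ← sub_add_cancel (altProd a b j _) ((-1 : F) ^ j • Finsupp.single x (1 : F)), smul_add,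
      smul_smul]
    exact add_mem (smul_mem_smallSubgroup h2.le (altProd_sub_mem ha hb hax hbx j))
      (hsmall _ (by simpa using h2))
  obtain ⟨m, rfl⟩ := Nat.exists_eq_succ_of_ne_zero hn
  have htop : (c⁻¹ ^ (m + 1) • c ^ (m + 1) • altProd a b (m + 1)) (Finsupp.single x 1) -
      Finsupp.single x ((-1) ^ (m + 1)) ∈ smallSubgroup v V := by
    rw [smul_smul, ← mul_pow, inv_mul_cancel₀ hc0, one_pow, one_smul]
    simpa using altProd_sub_mem ha hb hax hbx (m + 1)
  rw [antisymmetrizer, Finset.smul_sum, LinearMap.sum_apply, Finset.sum_range_succ, smul_add,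
    LinearMap.add_apply, add_sub_assoc, add_sub_assoc]
  refine add_mem (sum_mem fun j hj => ?_) (add_mem (hterm hb ha hbx hax m (by omega)) htop)
  have hj := Finset.mem_range.1 hj
  rw [smul_add, LinearMap.add_apply]
  exact add_mem (hterm hb ha hbx hax j (by omega)) (hterm ha hb hax hbx (j + 1) (by omega))

end Dominant

end WDigraph

end

/-! ### Valuations of ℚ(u) at 0, 1 and ∞. -/

noncomputable section

namespace WDigraph

theorem u_ne_zero : u ≠ 0 := RatFunc.X_ne_zero

open Classical in
/-- The valuation of `ℚ(u)` at infinity. -/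
def valInfty : Valuation K (WithZero (Multiplicative ℤ)) := RatFunc.inftyValuation ℚ

/-- The place of `ℚ(u)` at `u = a`. -/
def place (a : ℚ) : IsDedekindDomain.HeightOneSpectrum (Polynomial ℚ) where
  asIdeal := Ideal.span {Polynomial.X - Polynomial.C a}
  isPrime := (Ideal.span_singleton_prime (Polynomial.X_sub_C_ne_zero a)).2
    (Polynomial.prime_X_sub_C a)
  ne_bot := by simpa using Polynomial.X_sub_C_ne_zero a

/-- The valuation of `ℚ(u)` at `u = a`. -/
def valAt (a : ℚ) : Valuation K (WithZero (Multiplicative ℤ)) := (place a).valuation K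

theorem valInfty_u : valInfty u = WithZero.exp 1 := by
  classical
  exact RatFunc.inftyValuation.X ℚ

theorem valAt_polynomial_le (a : ℚ) (p : Polynomial ℚ) :
    valAt a (algebraMap (Polynomial ℚ) K p) ≤ 1 := (place a).valuation_le_one p

theorem valAt_self (a : ℚ) : valAt a (u - RatFunc.C a) = WithZero.exp (-1) := by
  have : u - RatFunc.C a =
      algebraMap (Polynomial ℚ) K (Polynomial.X - Polynomial.C a) := by
    rw [map_sub, RatFunc.algebraMap_X, RatFunc.algebraMap_C]
    rfl
  rw [this, valAt, IsDedekindDomain.HeightOneSpectrum.valuation_of_algebraMap]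
  exact (place a).intValuation_singleton (Polynomial.X_sub_C_ne_zero a) rfl

theorem valAt_of_ne {a b : ℚ} (hab : a ≠ b) : valAt a (u - RatFunc.C b) = 1 := by
  have : u - RatFunc.C b =
      algebraMap (Polynomial ℚ) K (Polynomial.X - Polynomial.C b) := by
    rw [map_sub, RatFunc.algebraMap_X, RatFunc.algebraMap_C]
    rfl
  rw [this, valAt, IsDedekindDomain.HeightOneSpectrum.valuation_of_algebraMap,
    IsDedekindDomain.HeightOneSpectrum.intValuation_eq_one_iff]
  change _ ∉ Ideal.span {_}
  rw [Ideal.mem_span_singleton, Polynomial.dvd_iff_isRoot]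
  simpa [sub_eq_zero] using hab

theorem valAt_u_le (a : ℚ) : valAt a u ≤ 1 := by
  rw [u, ← RatFunc.algebraMap_X]
  exact valAt_polynomial_le a _

theorem valAt_zero_u : valAt 0 u = WithZero.exp (-1) := by simpa using valAt_self 0
theorem valAt_zero_u_lt : valAt 0 u < 1 := by
  rw [valAt_zero_u, ← WithZero.exp_zero, WithZero.exp_lt_exp]
  norm_num
theorem valAt_zero_u_sub_one : valAt 0 (u - 1) = 1 := by
  simpa using valAt_of_ne (a := 0) (b := 1) (by norm_num)
theorem valAt_zero_u_add_one : valAt 0 (u + 1) = 1 := by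
  simpa using valAt_of_ne (a := 0) (b := -1) (by norm_num)
theorem valAt_one_u : valAt 1 u = 1 := by
  simpa using valAt_of_ne (a := 1) (b := 0) (by norm_num)
theorem valAt_one_u_sub_one : valAt 1 (u - 1) = WithZero.exp (-1) := by simpa using valAt_self 1
theorem valAt_one_u_add_one : valAt 1 (u + 1) = 1 := by
  simpa using valAt_of_ne (a := 1) (b := -1) (by norm_num)

theorem u_add_one_ne_zero : u + 1 ≠ 0 := fun h => by simpa [h] using valAt_one_u_add_one
theorem u_sub_one_ne_zero : u - 1 ≠ 0 := fun h => by simpa [h] using valAt_zero_u_sub_one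

theorem valInfty_u_inv_lt : valInfty u⁻¹ < 1 := by
  rw [map_inv₀, valInfty_u, ← WithZero.exp_neg,
    ← WithZero.exp_zero, WithZero.exp_lt_exp]; norm_num

/-- The sum of the orders of vanishing at `u = 0` and `u = 1`, up to sign. -/
def gr (k : K) : ℤ := WithZero.log (valAt 0 k) + WithZero.log (valAt 1 k)

theorem gr_mul (a b : K) (ha : a ≠ 0) (hb : b ≠ 0) : gr (a * b) = gr a + gr b := by
  simp only [gr, map_mul]
  rw [WithZero.log_mul (by simpa using ha) (by simpa using hb),
    WithZero.log_mul (by simpa using ha) (by simpa using hb)]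
  ring

theorem gr_inv (a : K) : gr a⁻¹ = -gr a := by
  simp only [gr, map_inv₀, WithZero.log_inv]
  ring

/-- The ratio of the coefficients at the ends of an edge, of an eigenvector of eigenvalue `-1`. -/
def EdgeKind.ratio : EdgeKind → K
  | .solid => -u ^ 2
  | .dashed => -(u * (u - 1) / (u + 1))

theorem EdgeKind.ratio_ne_zero (k : EdgeKind) : k.ratio ≠ 0 := by
  cases k <;> simp [ratio, u_ne_zero, u_add_one_ne_zero, u_sub_one_ne_zero]

/-- The solid ratio has a double zero at 0, the dashed one simple zeros at 0 and 1; adding both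
orders treats the two kinds alike. -/
theorem EdgeKind.gr_ratio (k : EdgeKind) : gr k.ratio = -2 := by
  cases k <;> simp [ratio, gr, Valuation.map_neg, map_div₀, valAt_zero_u, valAt_zero_u_sub_one,
    valAt_zero_u_add_one, valAt_one_u, valAt_one_u_sub_one, valAt_one_u_add_one]

/-! ### The operators τ_s in coordinates. -/

namespace EdgeKind

/-- The coefficient of the initial vertex `α` in `τ_s(α)`, for an edge from `α` to `β`. -/
def srcSrc : EdgeKind → K
  | .solid => 0
  | .dashed => u

/-- The coefficient of the final vertex `β` in `τ_s(α)`, for an edge from `α` to `β`. -/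
def tgtSrc : EdgeKind → K
  | .solid => 1
  | .dashed => u + 1

/-- The coefficient of the final vertex `β` in `τ_s(β)`, for an edge from `α` to `β`. -/
def tgtTgt : EdgeKind → K
  | .solid => u ^ 2 - 1
  | .dashed => u ^ 2 - u - 1

/-- The coefficient of the initial vertex `α` in `τ_s(β)`, for an edge from `α` to `β`. -/
def srcTgt : EdgeKind → K
  | .solid => u ^ 2
  | .dashed => u ^ 2 - u

end EdgeKind

namespace LabeledDigraph

variable {S V : Type*} (Γ : LabeledDigraph S V)

theorem edgeAt_spec (s : S) (α : V) : Γ.edgeAt s α ∈ Γ.edges ∧ (Γ.edgeAt s α).label = s ∧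
    ((Γ.edgeAt s α).src = α ∨ (Γ.edgeAt s α).tgt = α) := (Γ.existsUnique_edge s α).choose_spec.1

variable {Γ}

theorem edgeAt_eq {e : LabeledEdge S V} (he : e ∈ Γ.edges) {α : V} (h : e.src = α ∨ e.tgt = α) :
    Γ.edgeAt e.label α = e :=
  (Γ.existsUnique_edge e.label α).unique (Γ.edgeAt_spec _ _) ⟨he, rfl, h⟩

theorem tau_src {e : LabeledEdge S V} (he : e ∈ Γ.edges) :
    Γ.tau e.label (Finsupp.single e.src 1) =
      Finsupp.single e.src e.kind.srcSrc + Finsupp.single e.tgt e.kind.tgtSrc := by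
  rw [tau, Finsupp.linearCombination_single, one_smul, tauVertex, edgeAt_eq he (.inl rfl)]
  cases h : e.kind <;> simp [EdgeKind.srcSrc, EdgeKind.tgtSrc]

theorem tau_tgt {e : LabeledEdge S V} (he : e ∈ Γ.edges) :
    Γ.tau e.label (Finsupp.single e.tgt 1) =
      Finsupp.single e.tgt e.kind.tgtTgt + Finsupp.single e.src e.kind.srcTgt := by
  rw [tau, Finsupp.linearCombination_single, one_smul, tauVertex, edgeAt_eq he (.inr rfl)]
  cases h : e.kind <;> simp [EdgeKind.tgtTgt, EdgeKind.srcTgt, Γ.no_loops e he]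

/-- The edges labeled s partition the vertices into pairs, so τ_s is block diagonal with one 2 × 2
block per edge. -/
theorem tau_apply_src_and_tgt {e : LabeledEdge S V} (he : e ∈ Γ.edges) (w : V →₀ K) :
    Γ.tau e.label w e.src = e.kind.srcSrc * w e.src + e.kind.srcTgt * w e.tgt ∧
    Γ.tau e.label w e.tgt = e.kind.tgtSrc * w e.src + e.kind.tgtTgt * w e.tgt := by
  have hne := Γ.no_loops e he
  induction w using Finsupp.induction_linear with
  | zero => simp
  | add f g hf hg =>
    simp only [map_add, Finsupp.add_apply, hf.1, hf.2, hg.1, hg.2]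
    constructor <;> ring
  | single x k =>
    have hk : Finsupp.single x k = k • Finsupp.single x (1 : K) := by simp
    rw [hk, map_smul]
    by_cases h1 : e.src = x
    · subst h1
      rw [tau_src he]
      simp [hne, Ne.symm hne, mul_comm]
    by_cases h2 : e.tgt = x
    · subst h2
      rw [tau_tgt he]
      simp [hne, Ne.symm hne, mul_comm]
    have hspec := Γ.edgeAt_spec e.label x
    -- Here `x` lies on another edge `f` with the same label, disjoint from `e`, so all coordinates
    -- at the ends of `e` vanish.
    obtain ⟨f, hf⟩ : ∃ f, f = Γ.edgeAt e.label x := ⟨_, rfl⟩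
    rw [← hf] at hspec
    obtain ⟨hfe, hfl, hfx⟩ := hspec
    have hd : ∀ y, (e.src = y ∨ e.tgt = y) → f.src ≠ y ∧ f.tgt ≠ y := by
      intro y hy
      rw [← not_or]
      intro hfy
      have : f = e := by rw [← edgeAt_eq he hy, ← edgeAt_eq hfe hfy, hfl]
      subst this
      exact hfx.elim h1 h2
    obtain ⟨hs1, hs2⟩ := hd _ (.inl rfl)
    obtain ⟨ht1, ht2⟩ := hd _ (.inr rfl)
    rw [← hfl]
    rcases hfx with rfl | rfl
    · rw [tau_src hfe]
      simp [h1, h2, hs2.symm, ht2.symm]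
    · rw [tau_tgt hfe]
      simp [h1, h2, hs1.symm, ht1.symm]

theorem eq_ratio_mul_of_tau_eq_neg {e : LabeledEdge S V} (he : e ∈ Γ.edges) {w : V →₀ K}
    (hw : Γ.tau e.label w = -w) : w e.src = e.kind.ratio * w e.tgt := by
  have h := (tau_apply_src_and_tgt he w).1
  rw [hw, Finsupp.neg_apply] at h
  have h1 := u_add_one_ne_zero
  cases hk : e.kind <;> simp only [hk, EdgeKind.srcSrc, EdgeKind.srcTgt, EdgeKind.ratio] at h ⊢
  · linear_combination -h
  · field_simp
    linear_combination -h

variable {G : Type*} [LinearOrderedCommGroupWithZero G] {v : Valuation K G}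

theorem smul_tau_mem_smallSubgroup {c : K}
    (hc : ∀ k : EdgeKind, v (c * k.srcSrc) ≤ 1 ∧ v (c * k.srcTgt) ≤ 1 ∧ v (c * k.tgtSrc) ≤ 1 ∧
      v (c * k.tgtTgt) ≤ 1) (s : S) (w : V →₀ K) (hw : w ∈ smallSubgroup v V) :
    c • Γ.tau s w ∈ smallSubgroup v V := by
  intro x
  obtain ⟨he, hs, hx⟩ := Γ.edgeAt_spec s x
  generalize Γ.edgeAt s x = e at he hs hx
  subst hs
  obtain ⟨h1, h2, h3, h4⟩ := hc e.kind
  have key : ∀ a b : K, v (c * a) ≤ 1 → v (c * b) ≤ 1 → ∀ y z, v (c * (a * w y + b * w z)) < 1 := by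
    intro a b ha hb y z
    rw [mul_add, ← mul_assoc, ← mul_assoc]
    refine v.map_add_lt ?_ ?_ <;> rw [map_mul, mul_comm]
    · exact mul_lt_one_of_lt_of_le (hw y) ha
    · exact mul_lt_one_of_lt_of_le (hw z) hb
  rw [Finsupp.smul_apply, smul_eq_mul]
  rcases hx with rfl | rfl
  · rw [(tau_apply_src_and_tgt he w).1]
    exact key _ _ h1 h2 _ _
  · rw [(tau_apply_src_and_tgt he w).2]
    exact key _ _ h3 h4 _ _

theorem single_mem_smallSubgroup {k : K} (hk : v k < 1) (x : V) :
    Finsupp.single x k ∈ smallSubgroup v V := fun y => by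
  classical
  rw [Finsupp.single_apply]
  split_ifs <;> simp [hk]

end LabeledDigraph

end WDigraph

end

/-! ### Local sources and sinks of W-digraphs, and the grading. -/

noncomputable section

namespace WDigraph

theorem EdgeKind.valAt_zero_entries_le (k : EdgeKind) :
    valAt 0 k.srcSrc ≤ 1 ∧ valAt 0 k.srcTgt ≤ 1 ∧ valAt 0 k.tgtSrc ≤ 1 ∧ valAt 0 k.tgtTgt ≤ 1 := by
  have hu : u ∈ (valAt 0).integer := valAt_u_le 0
  change _ ∈ (valAt 0).integer ∧ _ ∈ (valAt 0).integer ∧ _ ∈ (valAt 0).integer ∧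
    _ ∈ (valAt 0).integer
  have h2 := pow_mem hu 2
  have h1 := one_mem (valAt 0).integer
  cases k
  · exact ⟨zero_mem _, h2, h1, sub_mem h2 h1⟩
  · exact ⟨hu, sub_mem h2 hu, add_mem hu h1, sub_mem (sub_mem h2 hu) h1⟩

/-- The entries of τ_s have degree at most 2 at infinity, which the antisymmetrizer's parameter -u⁻²
compensates. -/
theorem EdgeKind.valInfty_entries_le (k : EdgeKind) :
    valInfty (-(u ^ 2)⁻¹ * k.srcSrc) ≤ 1 ∧ valInfty (-(u ^ 2)⁻¹ * k.srcTgt) ≤ 1 ∧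
      valInfty (-(u ^ 2)⁻¹ * k.tgtSrc) ≤ 1 ∧ valInfty (-(u ^ 2)⁻¹ * k.tgtTgt) ≤ 1 := by
  have hu : u⁻¹ ∈ valInfty.integer := valInfty_u_inv_lt.le
  change _ ∈ valInfty.integer ∧ _ ∈ valInfty.integer ∧ _ ∈ valInfty.integer ∧ _ ∈ valInfty.integer
  have h2 := pow_mem hu 2
  have h1 := one_mem valInfty.integer
  have h0 := u_ne_zero
  cases k <;> simp only [srcSrc, srcTgt, tgtSrc, tgtTgt]
  · refine ⟨by simp, ?_, ?_, ?_⟩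
    · convert neg_mem h1 using 1; field_simp
    · convert neg_mem h2 using 1; field_simp
    · convert sub_mem h2 h1 using 1; field_simp; ring
  · refine ⟨?_, ?_, ?_, ?_⟩
    · convert neg_mem hu using 1; field_simp
    · convert sub_mem hu h1 using 1; field_simp; ring
    · convert neg_mem (add_mem hu h2) using 1; field_simp
    · convert sub_mem (add_mem hu h2) h1 using 1; field_simp; ring

/-- The column of the initial vertex has degree at most 1, so a local source becomes small. -/
theorem EdgeKind.valInfty_src_lt (k : EdgeKind) :
    valInfty (-(u ^ 2)⁻¹ * k.srcSrc) < 1 ∧ valInfty (-(u ^ 2)⁻¹ * k.tgtSrc) < 1 := by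
  have hu := valInfty_u_inv_lt
  have h0 := u_ne_zero
  have key : ∀ a : K, valInfty a ≤ 1 → valInfty (u⁻¹ * a) < 1 := fun a ha => by
    rw [map_mul]
    exact mul_lt_one_of_lt_of_le hu ha
  have hu' : u⁻¹ ∈ valInfty.integer := hu.le
  have h1 := one_mem valInfty.integer
  cases k <;> simp only [srcSrc, tgtSrc]
  · refine ⟨by simp, ?_⟩
    convert key (-u⁻¹) (neg_mem hu') using 2; field_simp
  · refine ⟨?_, ?_⟩
    · convert key (-1) (neg_mem h1) using 2; field_simp
    · convert key (-(1 + u⁻¹)) (neg_mem (add_mem h1 hu')) using 2; field_simp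

/-- At u = 0 the column of the final vertex reduces to that of -1, as needed at a local sink. -/
theorem EdgeKind.valAt_zero_tgt_lt (k : EdgeKind) :
    valAt 0 (k.tgtTgt + 1) < 1 ∧ valAt 0 k.srcTgt < 1 := by
  have hu : u ∈ (valAt 0).integer := valAt_u_le 0
  have h1 := one_mem (valAt 0).integer
  have key : ∀ a : K, valAt 0 a ≤ 1 → valAt 0 (u * a) < 1 := fun a ha => by
    rw [map_mul]
    exact mul_lt_one_of_lt_of_le valAt_zero_u_lt ha
  cases k <;> simp only [srcTgt, tgtTgt]
  · constructor <;> convert key u hu using 2 <;> ring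
  · constructor <;> convert key (u - 1) (sub_mem hu h1) using 2 <;> ring

namespace LabeledDigraph

variable {S V : Type*} {Γ : LabeledDigraph S V}

theorem mul_self_of_quadratic {F R : Type*} [Field F] [Ring R] [Algebra F R] {q : F} {a : R}
    (h : (a - algebraMap F R q) * (a + 1) = 0) : a * a = (q - 1) • a + q • (1 : R) := by
  rw [Algebra.algebraMap_eq_smul_one, sub_mul, mul_add, mul_one, smul_mul_assoc, one_mul,
    smul_add] at h
  rw [← sub_eq_zero, ← h]
  module

theorem IsWDigraph.tau_mul_self {M : CoxeterMatrix S} (hW : Γ.IsWDigraph M) (s : S) :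
    Γ.tau s * Γ.tau s = (u ^ 2 - 1) • Γ.tau s + u ^ 2 • (1 : Module.End K (V →₀ K)) := by
  obtain ⟨ρ, hρ⟩ := hW
  have h := congrArg ρ (RingQuot.mkAlgHom_rel K (HeckeRel.quadratic (M := M) s))
  simp only [map_mul, map_sub, map_add, map_one, map_zero, AlgHom.commutes] at h
  rw [show RingQuot.mkAlgHom K (HeckeRel M) (FreeAlgebra.ι K s) = HeckeAlgebra.T M s from rfl,
    hρ] at h
  exact mul_self_of_quadratic (F := K) (R := Module.End K (V →₀ K)) h

theorem map_altProd {R R' F : Type*} [Monoid R] [Monoid R'] [FunLike F R R'] [MonoidHomClass F R R']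
    (f : F) (a b : R) (n : ℕ) : f (altProd a b n) = altProd (f a) (f b) n := by
  induction n generalizing a b with
  | zero => simp [altProd]
  | succ n ih => simp [altProd, ih]

theorem IsWDigraph.altProd_tau {M : CoxeterMatrix S} (hW : Γ.IsWDigraph M) (s t : S)
    (h : 1 < M s t) :
    altProd (Γ.tau s) (Γ.tau t) (M s t) = altProd (Γ.tau t) (Γ.tau s) (M s t) := by
  obtain ⟨ρ, hρ⟩ := hW
  have h := congrArg ρ (RingQuot.mkAlgHom_rel K (HeckeRel.braid (M := M) s t h))
  rw [map_altProd, map_altProd, map_altProd, map_altProd] at h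
  rwa [show RingQuot.mkAlgHom K (HeckeRel M) (FreeAlgebra.ι K s) = HeckeAlgebra.T M s from rfl,
    show RingQuot.mkAlgHom K (HeckeRel M) (FreeAlgebra.ι K t) = HeckeAlgebra.T M t from rfl,
    hρ, hρ] at h

/-- There is an edge labeled `s` directed from `x` to `y`. -/
def LArrow (Γ : LabeledDigraph S V) (s : S) (x y : V) : Prop :=
  ∃ e ∈ Γ.edges, e.label = s ∧ e.src = x ∧ e.tgt = y

theorem arrow_iff {x y : V} : Γ.Arrow x y ↔ ∃ s, Γ.LArrow s x y :=
  ⟨fun ⟨e, he, h⟩ => ⟨e.label, e, he, rfl, h⟩, fun ⟨_, e, he, _, h⟩ => ⟨e, he, h⟩⟩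

theorem LArrow.src_unique {s : S} {x y z : V} (hx : Γ.LArrow s x z) (hy : Γ.LArrow s y z) :
    x = y := by
  obtain ⟨e, he, rfl, rfl, rfl⟩ := hx
  obtain ⟨f, hf, hl, rfl, h⟩ := hy
  rw [← edgeAt_eq he (.inr rfl), ← hl, edgeAt_eq hf (.inr h)]

theorem LArrow.tgt_unique {s : S} {x y z : V} (hx : Γ.LArrow s z x) (hy : Γ.LArrow s z y) :
    x = y := by
  obtain ⟨e, he, rfl, rfl, rfl⟩ := hx
  obtain ⟨f, hf, hl, h, rfl⟩ := hy
  rw [← edgeAt_eq he (.inl rfl), ← hl, edgeAt_eq hf (.inl h)]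

theorem smul_tau_single_mem_of_no_incoming {s : S} {x : V} (hx : ∀ z, ¬ Γ.LArrow s z x) :
    -(u ^ 2)⁻¹ • Γ.tau s (Finsupp.single x 1) ∈ smallSubgroup valInfty V := by
  obtain ⟨he, hs, h⟩ := Γ.edgeAt_spec s x
  generalize Γ.edgeAt s x = e at he hs h
  rcases h with rfl | rfl
  · subst hs
    rw [tau_src he, smul_add, Finsupp.smul_single, Finsupp.smul_single]
    exact add_mem (single_mem_smallSubgroup e.kind.valInfty_src_lt.1 _)
      (single_mem_smallSubgroup e.kind.valInfty_src_lt.2 _)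
  · exact absurd ⟨e, he, hs, rfl, rfl⟩ (hx e.src)

theorem tau_single_add_mem_of_no_outgoing {s : S} {x : V} (hx : ∀ z, ¬ Γ.LArrow s x z) :
    Γ.tau s (Finsupp.single x 1) + Finsupp.single x 1 ∈ smallSubgroup (valAt 0) V := by
  obtain ⟨he, hs, h⟩ := Γ.edgeAt_spec s x
  generalize Γ.edgeAt s x = e at he hs h
  rcases h with rfl | rfl
  · exact absurd ⟨e, he, hs, rfl, rfl⟩ (hx e.tgt)
  · subst hs
    rw [tau_tgt he, add_right_comm, ← Finsupp.single_add]
    exact add_mem (single_mem_smallSubgroup e.kind.valAt_zero_tgt_lt.1 _)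
      (single_mem_smallSubgroup e.kind.valAt_zero_tgt_lt.2 _)

/-- The vectors on which both `τ_s` and `τ_t` act as `-1`. -/
def signVectors (Γ : LabeledDigraph S V) (s t : S) : Set (V →₀ K) :=
  {w | Γ.tau s w = -w ∧ Γ.tau t w = -w}

theorem exists_ratio {s t : S} {x y : V} (h : Γ.LArrow s x y ∨ Γ.LArrow t x y) :
    ∃ ρ : K, ρ ≠ 0 ∧ gr ρ = -2 ∧ ∀ w ∈ Γ.signVectors s t, w x = ρ * w y := by
  rcases h with ⟨e, he, rfl, rfl, rfl⟩ | ⟨e, he, rfl, rfl, rfl⟩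
  · exact ⟨_, e.kind.ratio_ne_zero, e.kind.gr_ratio, fun w hw => eq_ratio_mul_of_tau_eq_neg he hw.1⟩
  · exact ⟨_, e.kind.ratio_ne_zero, e.kind.gr_ratio, fun w hw => eq_ratio_mul_of_tau_eq_neg he hw.2⟩

theorem antisymmetrizer_mem_signVectors {M : CoxeterMatrix S} (hW : Γ.IsWDigraph M) {s t : S}
    (h : 1 < M s t) (w : V →₀ K) :
    antisymmetrizer (-(u ^ 2)⁻¹) (Γ.tau s) (Γ.tau t) (M s t) w ∈ Γ.signVectors s t := by
  have hu : u ^ 2 ≠ 0 := pow_ne_zero 2 u_ne_zero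
  constructor
  · have := mul_antisymmetrizer (u ^ 2) hu (Γ.tau t) (M s t) (hW.tau_mul_self s)
    exact LinearMap.congr_fun this w
  · rw [antisymmetrizer_comm _ (hW.altProd_tau s t h)]
    have := mul_antisymmetrizer (u ^ 2) hu (Γ.tau s) (M s t) (hW.tau_mul_self t)
    exact LinearMap.congr_fun this w

theorem walk_of_local_source {M : CoxeterMatrix S} (hW : Γ.IsWDigraph M) {s t : S} (h : 1 < M s t)
    (x : V) (hx : ∀ z, ¬ (Γ.LArrow s z x ∨ Γ.LArrow t z x)) (m : ℕ) (y z : V)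
    (hy : Walk (fun a b => Γ.LArrow s a b ∨ Γ.LArrow t a b) x (m + 1) y)
    (hz : Γ.LArrow s z y ∨ Γ.LArrow t z y) :
    Walk (fun a b => Γ.LArrow s a b ∨ Γ.LArrow t a b) x m z := by
  refine walk_of_step_of_dominant valInfty gr gr_mul _ (Γ.signVectors s t) (-2) (by norm_num)
    (fun x y => exists_ratio) (fun x hx => ?_) x hx m y z hy hz
  refine ⟨_, antisymmetrizer_mem_signVectors hW h (Finsupp.single x 1),
    dominant_of_sub_mem (map_one _) (antisymmetrizer_source ?_ ?_ ?_ ?_ (by omega))⟩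
  · exact smul_tau_mem_smallSubgroup EdgeKind.valInfty_entries_le s
  · exact smul_tau_mem_smallSubgroup EdgeKind.valInfty_entries_le t
  · exact smul_tau_single_mem_of_no_incoming fun z hz => hx z (.inl hz)
  · exact smul_tau_single_mem_of_no_incoming fun z hz => hx z (.inr hz)

theorem walk_of_local_sink {M : CoxeterMatrix S} (hW : Γ.IsWDigraph M) {s t : S} (h : 1 < M s t)
    (x : V) (hx : ∀ z, ¬ (Γ.LArrow s x z ∨ Γ.LArrow t x z)) (m : ℕ) (y z : V)
    (hy : Walk (fun a b => Γ.LArrow s b a ∨ Γ.LArrow t b a) x (m + 1) y)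
    (hz : Γ.LArrow s y z ∨ Γ.LArrow t y z) :
    Walk (fun a b => Γ.LArrow s b a ∨ Γ.LArrow t b a) x m z := by
  refine walk_of_step_of_dominant (valAt 0) (fun k => -gr k)
    (fun a b ha hb => by rw [gr_mul a b ha hb]; ring) _ (Γ.signVectors s t) (-2) (by norm_num)
    (fun x y hxy => ?_) (fun x hx => ?_) x hx m y z hy hz
  -- Reversing a step inverts the ratio, so its degree for `-gr` is again -2.
  · obtain ⟨ρ, hρ, hd, hw⟩ := exists_ratio hxy
    refine ⟨ρ⁻¹, inv_ne_zero hρ, by simp [gr_inv, hd], fun w hwm => ?_⟩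
    rw [hw w hwm, inv_mul_cancel_left₀ hρ]
  · have hc : -(u ^ 2)⁻¹ ≠ 0 := neg_ne_zero.2 (inv_ne_zero (pow_ne_zero 2 u_ne_zero))
    have hmem := antisymmetrizer_mem_signVectors hW h (Finsupp.single x 1)
    have htau : ∀ r, ∀ w ∈ smallSubgroup (valAt 0) V, Γ.tau r w ∈ smallSubgroup (valAt 0) V :=
      fun r w hw => by
        simpa using smul_tau_mem_smallSubgroup (c := 1)
          (by simpa using EdgeKind.valAt_zero_entries_le) r w hw
    -- The scalar (-u²)^n, with n = `M s t`, preserves the eigenvector equations and makes the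
    -- longest word lead at u = 0.
    refine ⟨((-(u ^ 2)⁻¹)⁻¹ ^ M s t • antisymmetrizer (-(u ^ 2)⁻¹) (Γ.tau s) (Γ.tau t) (M s t))
      (Finsupp.single x 1), ⟨?_, ?_⟩, dominant_of_sub_mem (k := (-1) ^ M s t) (by simp)
        (antisymmetrizer_sink hc ?_ (htau s) (htau t) ?_ ?_ (by omega))⟩
    · rw [LinearMap.smul_apply, map_smul, hmem.1, smul_neg]
    · rw [LinearMap.smul_apply, map_smul, hmem.2, smul_neg]
    · rw [inv_neg, inv_inv, Valuation.map_neg, map_pow]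
      exact pow_lt_one₀ zero_le valAt_zero_u_lt two_ne_zero
    · exact tau_single_add_mem_of_no_outgoing fun z hz => hx z (.inl hz)
    · exact tau_single_add_mem_of_no_outgoing fun z hz => hx z (.inr hz)

theorem IsConnected.reflTransGen (hconn : Γ.IsConnected) (x y : V) :
    Relation.ReflTransGen (fun a b => Γ.Arrow a b ∨ Γ.Arrow b a) x y := by
  have h := (SimpleGraph.reachable_iff_reflTransGen x y).1 (hconn.preconnected x y)
  refine h.lift id fun a b h => ?_
  exact ((SimpleGraph.fromRel_adj _ _ _).1 h).2

/-- A connected `W`-digraph with a source or a sink is graded. -/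
theorem IsWDigraph.exists_grading {M : CoxeterMatrix S} (hM : ∀ s t : S, M s t ≠ 0)
    (hW : Γ.IsWDigraph M) (hconn : Γ.IsConnected)
    (hΓ : (∃ σ : V, Γ.IsSource σ) ∨ (∃ ω : V, Γ.IsSink ω)) :
    ∃ h : V → ℤ, ∀ x y, Γ.Arrow x y → h y = h x + 1 := by
  have hlt : ∀ s t, s ≠ t → 1 < M s t := fun s t hst => by
    have := hM s t
    have := M.off_diagonal s t hst
    omega
  rcases hΓ with ⟨σ, hσ⟩ | ⟨ω, hω⟩
  · obtain ⟨h, hh⟩ := WDigraph.exists_grading (A := Γ.LArrow) (σ := σ)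
      (fun _ _ _ _ => LArrow.src_unique) (fun s t hst => walk_of_local_source hW (hlt s t hst))
      (fun s x hs => hσ x (arrow_iff.2 ⟨s, hs⟩))
      (fun x => by simpa only [arrow_iff] using hconn.reflTransGen σ x)
    refine ⟨h, fun x y hxy => ?_⟩
    obtain ⟨s, hs⟩ := arrow_iff.1 hxy
    exact hh s x y hs
  · obtain ⟨h, hh⟩ := WDigraph.exists_grading (A := fun s a b => Γ.LArrow s b a) (σ := ω)
      (fun _ _ _ _ => LArrow.tgt_unique) (fun s t hst => walk_of_local_sink hW (hlt s t hst))
      (fun s x hs => hω x (arrow_iff.2 ⟨s, hs⟩))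
      (fun x => by simpa only [arrow_iff, or_comm] using hconn.reflTransGen ω x)
    refine ⟨fun x => -h x, fun x y hxy => ?_⟩
    obtain ⟨s, hs⟩ := arrow_iff.1 hxy
    have := hh s y x hs
    simp only [this]
    ring

theorem numEdges_eq_of_grading {h : V → ℤ} (hh : ∀ x y, Γ.Arrow x y → h y = h x + 1) {α β : V}
    (π : Γ.DirectedPath α β) : (Γ.numEdges π : ℤ) = h β - h α := by
  let := Γ.dir
  induction π with
  | nil => simp
  | cons p e ih =>
    have := hh _ _ ⟨e.1, e.2⟩
    rw [numEdges, Quiver.Path.length_cons]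
    push_cast
    rw [numEdges] at ih
    omega

end LabeledDigraph

end WDigraph

end

theorem theorem8 {S V : Type*} (M : CoxeterMatrix S) (hM : ∀ s t : S, M s t ≠ 0)
    (Γ : WDigraph.LabeledDigraph S V) (hW : Γ.IsWDigraph M) (hconn : Γ.IsConnected)
    (hΓ : (∃ σ : V, Γ.IsSource σ) ∨ (∃ ω : V, Γ.IsSink ω))
    (α β : V) (π₁ π₂ : Γ.DirectedPath α β) :
    Γ.numEdges π₁ = Γ.numEdges π₂ := by
  obtain ⟨h, hh⟩ := hW.exists_grading hM hconn hΓ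
  have h₁ := WDigraph.LabeledDigraph.numEdges_eq_of_grading hh π₁
  have h₂ := WDigraph.LabeledDigraph.numEdges_eq_of_grading hh π₂
  omega
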